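/- Conventions. An $m\times r$ real matrix $\beta$ of full column rank $r$ is an unordered GLT structure if the pivot rows $l_1,\dots,l_r$ of its columns ($l_j$ is the row of the first nonzero entry of column $j$) are pairwise distinct. Its sparsity matrix is $\delta=(1\{\beta_{ij}\neq 0\})_{ij}$. A signed permutation of $\beta$ is a matrix $\beta P_{\pm}P_{\rho}$ with $P_{\pm}=\mathrm{Diag}(\pm1,\dots,\pm1)$ and $P_\rho$ a permutation matrix. $\Theta_\delta$ is the set of all unordered GLT structures with sparsity matrix $\delta$ together with all their signed permutations; "measure 0" refers to Lebesgue measure in the nonzero loadings, for each order of the columns. A binary $m\times r$ matrix $\delta$ satisfies the 3579 counting rule $CR(r,1)$ if for each $q=1,\dots,r$ every submatrix built from $q$ columns of $\delta$ has at least $2q+1$ nonzero rows. A matrix $\beta\in\mathbb R^{m\times r}$ has the row deletion property AR if, whenever one row is deleted, two disjoint sets of the remaining rows each form a submatrix of rank $r$. For $\beta\in\Theta_\delta$ and a positive definite diagonal $\Sigma$, variance identification holds at $(\beta,\Sigma)$ if for every decomposition $\beta\beta^\top+\Sigma=\tilde\beta\tilde\beta^\top+\tilde\Sigma$ with an $m\times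 r$ unordered GLT matrix $\tilde\beta$ and a positive definite diagonal $\tilde\Sigma$ one has $\tilde\Sigma=\Sigma$, i.e. $\tilde\beta\tilde\beta^\top=\beta\beta^\top$. Statement. Let $\delta$ be the sparsity matrix of an $m\times r$ unordered GLT structure. (a) If $\delta$ satisfies $CR(r,1)$, then for all $\beta\in\Theta_\delta$ except for a set of measure 0 and for every positive definite diagonal $\Sigma$, variance identification holds at $(\beta,\Sigma)$: for any other decomposition $\beta\beta^\top+\Sigma=\tilde\beta\tilde\beta^\top+\tilde\Sigma$ with $\tilde\beta$ an $m\times r$ unordered GLT matrix and $\tilde\Sigma$ positive definite diagonal, $\tilde\Sigma=\Sigma$, $\tilde\beta\tilde\beta^\top=\beta\beta^\top$, and $\tilde\beta=\beta P_\pm P_\rho$ is a signed permutation of $\beta$. (b) If $\delta$ violates $CR(r,1)$, then AR fails for every $\beta\in\Theta_\delta$. (c) Let $r=1$, or $r=2$, or $r=3$, where for $r=3$ it is assumed that $\delta$ has at least $7$ nonzero rows. Then $CR(r,1)$ is necessary and sufficient for variance identification: $\delta$ satisfies $CR(r,1)$ if and only if, for all $\beta\in\Theta_\delta$ except for a set of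 measure 0, variance identification holds at $(\beta,\Sigma)$ for every positive definite diagonal $\Sigma$; moreover, if $\delta$ violates $CR(r,1)$, then variance identification fails at $(\beta,\Sigma)$ for every $\beta\in\Theta_\delta$ and every positive definite diagonal $\Sigma$. -/

import Mathlib

open Matrix MeasureTheory

noncomputable section

/-- `l` is the pivot row of column `j` of `β`: the row of its first nonzero entry. -/
def IsPivotRow {m r : ℕ} (β : Matrix (Fin m) (Fin r) ℝ) (j : Fin r) (l : Fin m) : Prop :=
  (∀ i, i < l → β i j = 0) ∧ β l j ≠ 0

/-- Unordered GLT structure: full column rank, and the columns (all nonzero) have pairwise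
distinct pivot rows. -/
def IsUnorderedGLT {m r : ℕ} (β : Matrix (Fin m) (Fin r) ℝ) : Prop :=
  β.rank = r ∧ ∃ l : Fin r → Fin m, Function.Injective l ∧ ∀ j, IsPivotRow β j (l j)

open Classical in
/-- The sparsity matrix of `β`: the 0/1 indicator of its nonzero entries. -/
def sparsityMatrix {m r : ℕ} (β : Matrix (Fin m) (Fin r) ℝ) : Matrix (Fin m) (Fin r) Bool :=
  fun i j => decide (β i j ≠ 0)

/-- The binary matrix `δ` is the sparsity matrix of some unordered GLT structure. -/
def IsUnorderedGLTSparsity {m r : ℕ} (δ : Matrix (Fin m) (Fin r) Bool) : Prop :=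
  ∃ β : Matrix (Fin m) (Fin r) ℝ, IsUnorderedGLT β ∧ sparsityMatrix β = δ

/-- `B` is a signed permutation of `β`: `B = β P_± P_ρ` with `P_±` a diagonal matrix of signs and
`P_ρ` a permutation matrix. -/
def IsSignedPermutation {m r : ℕ} (B β : Matrix (Fin m) (Fin r) ℝ) : Prop :=
  ∃ (ε : Fin r → ℝ) (ρ : Equiv.Perm (Fin r)), (∀ j, ε j = 1 ∨ ε j = -1) ∧
    B = β * Matrix.diagonal ε * ρ.permMatrix ℝ

/-- `Θ_δ`: all unordered GLT structures with sparsity matrix `δ` and all their signed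
permutations. -/
def Theta {m r : ℕ} (δ : Matrix (Fin m) (Fin r) Bool) : Set (Matrix (Fin m) (Fin r) ℝ) :=
  {B | ∃ β : Matrix (Fin m) (Fin r) ℝ,
    IsUnorderedGLT β ∧ sparsityMatrix β = δ ∧ IsSignedPermutation B β}

/-- The matrix whose entries at the positions marked by `δ` are the free parameters `x`, and whose
other entries are zero. -/
def fillIn {m r : ℕ} (δ : Matrix (Fin m) (Fin r) Bool)
    (x : {p : Fin m × Fin r // δ p.1 p.2 = true} → ℝ) : Matrix (Fin m) (Fin r) ℝ :=
  fun i j => if h : δ i j = true then x ⟨(i, j), h⟩ else 0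

/-- `N` has measure 0 in `Θ_δ`. The set `Θ_δ` is a finite union, over the permutations `ρ` of the
columns, of sets parametrized by the vector of the loadings that are not structurally zero; `N` has
measure 0 if, in each of these pieces, the parameters of the matrices in `N` form a Lebesgue null
set. -/
def IsNullInTheta {m r : ℕ} (δ : Matrix (Fin m) (Fin r) Bool)
    (N : Set (Matrix (Fin m) (Fin r) ℝ)) : Prop :=
  ∀ ρ : Equiv.Perm (Fin r),
    volume {x : {p : Fin m × Fin r // δ p.1 p.2 = true} → ℝ |
      (fillIn δ x).submatrix id ρ ∈ N} = 0

open Classical in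
/-- The number of nonzero rows of the submatrix of `δ` built from the columns in `J`. -/
def nonzeroRows {m r : ℕ} (δ : Matrix (Fin m) (Fin r) Bool) (J : Finset (Fin r)) : ℕ :=
  (Finset.univ.filter (fun i : Fin m => ∃ j ∈ J, δ i j = true)).card

/-- Counting rule `CR(r, s)`: every submatrix of `q = 1, …, r` columns has at least `2 q + s`
nonzero rows. The 3579 counting rule is the case `s = 1`. -/
def CountingRule {m r : ℕ} (δ : Matrix (Fin m) (Fin r) Bool) (s : ℕ) : Prop :=
  ∀ J : Finset (Fin r), J.Nonempty → 2 * J.card + s ≤ nonzeroRows δ J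

/-- Row deletion property `AR`: whenever a row is deleted, two disjoint submatrices (sets of rows)
of rank `r` remain. -/
def RowDeletionProperty {m r : ℕ} (β : Matrix (Fin m) (Fin r) ℝ) : Prop :=
  ∀ i : Fin m, ∃ S T : Finset (Fin m), i ∉ S ∧ i ∉ T ∧ Disjoint S T ∧
    (β.submatrix (fun k : S => (k : Fin m)) id).rank = r ∧
    (β.submatrix (fun k : T => (k : Fin m)) id).rank = r

/-- `(B, τ)` is a factor decomposition, with an unordered GLT loading matrix `B` and positive
idiosyncratic variances `τ`, of the covariance matrix `Ω`. -/
def IsGLTDecomposition {m r : ℕ} (Ω : Matrix (Fin m) (Fin m) ℝ)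
    (B : Matrix (Fin m) (Fin r) ℝ) (τ : Fin m → ℝ) : Prop :=
  IsUnorderedGLT B ∧ (∀ i, 0 < τ i) ∧ Ω = B * Bᵀ + Matrix.diagonal τ

/-- Variance identification at `(β, σ)`: every decomposition of `Ω = β βᵀ + diag σ` with an
unordered GLT loading matrix of the same size has the same idiosyncratic variances and the same
cross-covariance matrix. -/
def VarianceIdentified {m r : ℕ} (β : Matrix (Fin m) (Fin r) ℝ) (σ : Fin m → ℝ) : Prop :=
  ∀ (B : Matrix (Fin m) (Fin r) ℝ) (τ : Fin m → ℝ),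
    IsGLTDecomposition (β * βᵀ + Matrix.diagonal σ) B τ → τ = σ ∧ B * Bᵀ = β * βᵀ

end

/-
Sufficiency. If the row deletion property holds, then any row `i` can be dropped so that two
disjoint nonsingular blocks `S`, `T` of rows remain. The off-diagonal blocks of `β βᵀ` and `B Bᵀ`
agree, and the rank-`r` block on `S × T` determines `(β βᵀ) i i` from off-diagonal entries, so
`B Bᵀ = β βᵀ`. Then `B = β Q` with `Q` orthogonal, and comparing pivot rows forces `Q` to be a
signed permutation. Under the counting rule, Hall's theorem finds in the remaining rows, for each
column, two private rows with structurally nonzero loadings; the two corresponding minors are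
nonzero polynomials in the loadings, hence nonzero almost everywhere.

Necessity. Let `X` be a set of rows. For every positive definite `W = C Cᵀ`, multiplying the rows
in `X` by `C` and the others by `C⁻ᵀ` keeps the products between `X` and its complement. If `W` is
near `1` and deforms no other off-diagonal entry of `β βᵀ`, the change on the diagonal can be
absorbed in `Σ`, and Gram-Schmidt rotates the new loading matrix to a GLT structure. One column
with at most two nonzero rows admits such a `W = 1 + h u uᵀ`. For two columns with at most four
nonzero rows, take `X` to be their two pivot rows and `W = 1 + h u uᵀ + k v vᵀ` with `u`, `v` dual
to the pivot rows: the only remaining constraint is one equation in `(h, k)`, which has nonzero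
solutions arbitrarily close to `0`.
-/

section Rank

variable {K ι κ : Type*} [Field K] [Fintype κ]

theorem rank_eq_card_iff_mulVec_injective {A : Matrix ι κ K} :
    A.rank = Fintype.card κ ↔ Function.Injective A.mulVec := by
  rw [mulVec_injective_iff, linearIndependent_iff_card_eq_finrank_span, eq_comm,
    rank_eq_finrank_span_cols]
  rfl

theorem rank_eq_card_iff_exists_mul_eq_one [Fintype ι] [DecidableEq κ] {A : Matrix ι κ K} :
    A.rank = Fintype.card κ ↔ ∃ L : Matrix κ ι K, L * A = 1 := by
  rw [← vecMul_surjective_iff_exists_left_inverse]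
  have hvec : A.vecMul = Aᵀ.mulVecLin := by
    ext v : 1
    rw [mulVecLin_apply, mulVec_transpose]
  rw [hvec, ← rank_transpose, ← LinearMap.range_eq_top, Matrix.rank]
  refine ⟨fun h => Submodule.eq_top_of_finrank_eq (by simpa using h), fun h => ?_⟩
  rw [h, finrank_top, Module.finrank_fintype_fun_eq_card]

end Rank

section Pivots

variable {m r : ℕ} {β : Matrix (Fin m) (Fin r) ℝ} {l : Fin r → Fin m}

theorem exists_min_pivotRow_mulVec (hl : Function.Injective l) (hβ : ∀ j, IsPivotRow β j (l j))
    {v : Fin r → ℝ} (hv : v ≠ 0) :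
    ∃ a, (∀ b, v b ≠ 0 → l a ≤ l b) ∧ (∀ i < l a, (β *ᵥ v) i = 0) ∧ (β *ᵥ v) (l a) ≠ 0 := by
  obtain ⟨j, hj⟩ := Function.ne_iff.mp hv
  obtain ⟨a, ha, hmin⟩ := Finset.exists_min_image {b | v b ≠ 0} l ⟨j, by simpa using hj⟩
  simp only [Finset.mem_filter_univ] at ha hmin
  have hterm : ∀ i b, (v b ≠ 0 → i < l b) → β i b * v b = 0 := fun i b hib => by
    by_cases hb : v b = 0
    · rw [hb, mul_zero]
    · rw [(hβ b).1 i (hib hb), zero_mul]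
  have hpivot : (β *ᵥ v) (l a) = β (l a) a * v a := Fintype.sum_eq_single a fun b hba =>
    hterm (l a) b fun hb => (hmin b hb).lt_of_ne (hl.ne hba.symm)
  refine ⟨a, hmin, fun i hi => ?_, hpivot ▸ mul_ne_zero (hβ a).2 ha⟩
  exact Fintype.sum_eq_zero _ fun b => hterm i b fun hb => hi.trans_le (hmin b hb)

theorem rank_eq_of_isPivotRow (hl : Function.Injective l) (hβ : ∀ j, IsPivotRow β j (l j)) :
    β.rank = r := by
  have hinj : Function.Injective β.mulVec := by
    refine (injective_iff_map_eq_zero β.mulVecLin).mpr fun v hv => ?_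
    by_contra hne
    obtain ⟨a, -, -, ha⟩ := exists_min_pivotRow_mulVec hl hβ hne
    exact ha (congrFun hv (l a))
  simpa using rank_eq_card_iff_mulVec_injective.mpr hinj

theorem isUnorderedGLT_of_isPivotRow (hl : Function.Injective l)
    (hβ : ∀ j, IsPivotRow β j (l j)) : IsUnorderedGLT β :=
  ⟨rank_eq_of_isPivotRow hl hβ, l, hl, hβ⟩

theorem pivotRow_mul_le (hl : Function.Injective l) (hβ : ∀ j, IsPivotRow β j (l j))
    {s : ℕ} {Q : Matrix (Fin r) (Fin s) ℝ} {j : Fin s} {k : Fin m}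
    (hk : IsPivotRow (β * Q) j k) {b : Fin r} (hb : Q b j ≠ 0) : k ≤ l b := by
  have hQ : (fun a => Q a j) ≠ 0 := fun h => hb (congrFun h b)
  obtain ⟨a, hmin, -, ha⟩ := exists_min_pivotRow_mulVec hl hβ hQ
  have hka : k ≤ l a := not_lt.mp fun hlt => ha (hk.1 (l a) hlt)
  exact hka.trans (hmin b hb)

end Pivots

section SignedPermutations

theorem exists_mul_transpose_eq_one_of_mul_transpose_eq {R ι κ : Type*} [CommRing R] [Fintype ι]
    [Fintype κ] [DecidableEq κ] {A B : Matrix ι κ R} {L : Matrix κ ι R} (hL : L * A = 1)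
    (h : B * Bᵀ = A * Aᵀ) : ∃ Q : Matrix κ κ R, Q * Qᵀ = 1 ∧ B = A * Q := by
  have hAQ : B * (L * B)ᵀ = A := by
    rw [transpose_mul, ← Matrix.mul_assoc, h, Matrix.mul_assoc, ← transpose_mul, hL,
      transpose_one, Matrix.mul_one]
  have hQ : L * B * (L * B)ᵀ = 1 := by rw [Matrix.mul_assoc, hAQ, hL]
  refine ⟨L * B, hQ, ?_⟩
  calc B = B * ((L * B)ᵀ * (L * B)) := by rw [mul_eq_one_comm.mp hQ, Matrix.mul_one]
    _ = A * (L * B) := by rw [← Matrix.mul_assoc, hAQ]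

theorem exists_eq_diagonal_mul_permMatrix {R κ : Type*} [CommRing R] [NoZeroDivisors R]
    [Fintype κ] [DecidableEq κ] {Q : Matrix κ κ R} (hQ : Q * Qᵀ = 1) {ρ : Equiv.Perm κ}
    (hρ : ∀ a b, Q a b ≠ 0 → ρ a = b) :
    ∃ ε : κ → R, (∀ a, ε a = 1 ∨ ε a = -1) ∧ Q = diagonal ε * ρ.permMatrix R := by
  refine ⟨fun a => Q a (ρ a), fun a => mul_self_eq_one_iff.mp ?_, ?_⟩
  · have haa : ∑ b, Q a b * Q a b = 1 := by simpa [mul_apply] using congrFun (congrFun hQ a) a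
    rwa [Fintype.sum_eq_single (ρ a) fun b hb => by
      rw [not_ne_iff.mp fun h => hb (hρ a b h).symm, zero_mul]] at haa
  · ext a b
    rw [diagonal_mul, Equiv.Perm.permMatrix, PEquiv.toMatrix_toPEquiv_apply, Pi.single_apply]
    split_ifs with h
    · rw [h, mul_one]
    · rw [mul_zero, not_ne_iff.mp fun hab => h (hρ a b hab).symm]

variable {m r : ℕ} {β B : Matrix (Fin m) (Fin r) ℝ}

theorem IsUnorderedGLT.exists_mul_eq_one (hβ : IsUnorderedGLT β) :
    ∃ L : Matrix (Fin r) (Fin m) ℝ, L * β = 1 :=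
  rank_eq_card_iff_exists_mul_eq_one.mp (by simpa using hβ.1)

theorem IsUnorderedGLT.isSignedPermutation (hβ : IsUnorderedGLT β) (hB : IsUnorderedGLT B)
    (h : B * Bᵀ = β * βᵀ) : IsSignedPermutation B β := by
  obtain ⟨L, hL⟩ := hβ.exists_mul_eq_one
  obtain ⟨Q, hQ, hBQ⟩ := exists_mul_transpose_eq_one_of_mul_transpose_eq hL h
  have hβQ : β = B * Qᵀ := by rw [hBQ, Matrix.mul_assoc, hQ, Matrix.mul_one]
  obtain ⟨-, l, hl, hlβ⟩ := hβ
  obtain ⟨-, k, hk, hkB⟩ := hB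
  have hkl : ∀ a b, Q a b ≠ 0 → k b = l a := fun a b hab =>
    le_antisymm (pivotRow_mul_le hl hlβ (hBQ ▸ hkB b) hab)
      (pivotRow_mul_le (Q := Qᵀ) hk hkB (hβQ ▸ hlβ a) hab)
  have hrow : ∀ a, ∃ b, Q a b ≠ 0 := fun a => by
    by_contra! h0
    simpa [mul_apply, h0] using congrFun (congrFun hQ a) a
  choose π hπ using hrow
  have hπ_inj : Function.Injective π := fun a b hab => hl <| by
    rw [← hkl a _ (hπ a), ← hkl b _ (hπ b), hab]
  obtain ⟨ε, hε, hQε⟩ := exists_eq_diagonal_mul_permMatrix hQ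
    (ρ := Equiv.ofBijective π (Finite.injective_iff_bijective.mp hπ_inj))
    fun a b hab => hk ((hkl a _ (hπ a)).trans (hkl a b hab).symm)
  exact ⟨ε, _, hε, by rw [hBQ, hQε, Matrix.mul_assoc]⟩

end SignedPermutations

section AndersonRubin

-- `L * BS` and `BTᵀ * Kᵀ` are inverse to each other, so `B = b * (L * BS)`.
theorem mul_transpose_eq_of_offDiag_blocks_eq {R ι₁ ι₂ ι₃ κ : Type*} [CommRing R] [Fintype ι₁]
    [Fintype ι₂] [Fintype κ] [DecidableEq κ] {bS BS : Matrix ι₁ κ R} {bT BT : Matrix ι₂ κ R}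
    {b B : Matrix ι₃ κ R} {L : Matrix κ ι₁ R} {K : Matrix κ ι₂ R} (hL : L * bS = 1)
    (hK : K * bT = 1) (hST : BS * BTᵀ = bS * bTᵀ) (hT : B * BTᵀ = b * bTᵀ)
    (hS : BS * Bᵀ = bS * bᵀ) : B * Bᵀ = b * bᵀ := by
  have hKT : bTᵀ * Kᵀ = 1 := by rw [← transpose_mul, hK, transpose_one]
  have hXY : L * BS * (BTᵀ * Kᵀ) = 1 := by
    rw [Matrix.mul_assoc, ← Matrix.mul_assoc BS, hST, Matrix.mul_assoc bS, hKT, Matrix.mul_one, hL]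
  have hB : B = b * (L * BS) := by
    calc B = B * (BTᵀ * Kᵀ * (L * BS)) := by rw [mul_eq_one_comm.mp hXY, Matrix.mul_one]
      _ = b * (bTᵀ * Kᵀ) * (L * BS) := by
        rw [← Matrix.mul_assoc, ← Matrix.mul_assoc B, hT, Matrix.mul_assoc b]
      _ = b * (L * BS) := by rw [hKT, Matrix.mul_one]
  calc B * Bᵀ = b * (L * BS) * Bᵀ := by rw [← hB]
    _ = b * (L * bS * bᵀ) := by rw [Matrix.mul_assoc, Matrix.mul_assoc L, hS, ← Matrix.mul_assoc L]
    _ = b * bᵀ := by rw [hL, Matrix.one_mul]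

variable {m r : ℕ} {β B : Matrix (Fin m) (Fin r) ℝ}

theorem RowDeletionProperty.mul_transpose_eq (hβ : RowDeletionProperty β)
    (h : ∀ i k, i ≠ k → (B * Bᵀ) i k = (β * βᵀ) i k) : B * Bᵀ = β * βᵀ := by
  have hblock : ∀ {ι ι' : Type} (f : ι → Fin m) (g : ι' → Fin m), (∀ a b, f a ≠ g b) →
      B.submatrix f id * (B.submatrix g id)ᵀ = β.submatrix f id * (β.submatrix g id)ᵀ :=
    fun f g hfg => ext fun a b => h _ _ (hfg a b)
  ext i k
  obtain rfl | hik := eq_or_ne i k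
  · obtain ⟨S, T, hiS, hiT, hST, hS, hT⟩ := hβ i
    obtain ⟨L, hL⟩ := rank_eq_card_iff_exists_mul_eq_one.mp (hS.trans (Fintype.card_fin r).symm)
    obtain ⟨K, hK⟩ := rank_eq_card_iff_exists_mul_eq_one.mp (hT.trans (Fintype.card_fin r).symm)
    have hi := mul_transpose_eq_of_offDiag_blocks_eq hL hK
      (hblock _ _ fun a b hab => Finset.disjoint_left.mp hST a.2 (hab ▸ b.2))
      (hblock (fun _ : Unit => i) _ fun _ b hb => hiT (hb ▸ b.2))
      (hblock _ _ fun a _ ha => hiS (ha ▸ a.2))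
    exact congrFun (congrFun hi ()) ()
  · exact h i k hik

theorem RowDeletionProperty.eq_and_mul_transpose_eq (hβ : RowDeletionProperty β) {σ τ : Fin m → ℝ}
    (h : β * βᵀ + diagonal σ = B * Bᵀ + diagonal τ) : τ = σ ∧ B * Bᵀ = β * βᵀ := by
  have hB : B * Bᵀ = β * βᵀ := hβ.mul_transpose_eq fun i k hik => by
    simpa [hik] using (congrFun (congrFun h i) k).symm
  rw [hB] at h
  exact ⟨(diagonal_injective (add_left_cancel h)).symm, hB⟩

end AndersonRubin

section Sparsity

variable {m r : ℕ} {β A : Matrix (Fin m) (Fin r) ℝ} {δ : Matrix (Fin m) (Fin r) Bool}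

theorem sparsityMatrix_eq_true_iff {i : Fin m} {j : Fin r} :
    sparsityMatrix β i j = true ↔ β i j ≠ 0 :=
  decide_eq_true_iff

theorem isPivotRow_iff_sparsityMatrix {j : Fin r} {l : Fin m} : IsPivotRow β j l ↔
    (∀ i < l, sparsityMatrix β i j = false) ∧ sparsityMatrix β l j = true := by
  simp only [← Bool.not_eq_true, sparsityMatrix_eq_true_iff, not_not, IsPivotRow]

theorem IsUnorderedGLT.of_sparsityMatrix_eq (hβ : IsUnorderedGLT β)
    (h : sparsityMatrix A = sparsityMatrix β) : IsUnorderedGLT A := by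
  obtain ⟨-, l, hl, hlβ⟩ := hβ
  refine isUnorderedGLT_of_isPivotRow hl fun j => ?_
  rw [isPivotRow_iff_sparsityMatrix, h, ← isPivotRow_iff_sparsityMatrix]
  exact hlβ j

theorem mul_diagonal_mul_permMatrix_apply (β : Matrix (Fin m) (Fin r) ℝ) (ε : Fin r → ℝ)
    (ρ : Equiv.Perm (Fin r)) (i : Fin m) (j : Fin r) :
    (β * diagonal ε * ρ.permMatrix ℝ) i j = β i (ρ.symm j) * ε (ρ.symm j) := by
  rw [Equiv.Perm.permMatrix, PEquiv.mul_toMatrix_toPEquiv, submatrix_apply, id, mul_diagonal]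

theorem exists_perm_eq_submatrix_sparsityMatrix (hβ : β ∈ Theta δ) :
    ∃ ρ : Equiv.Perm (Fin r), δ = (sparsityMatrix β).submatrix id ρ := by
  obtain ⟨A, -, rfl, ε, ρ, hε, rfl⟩ := hβ
  refine ⟨ρ, ext fun i j => ?_⟩
  have hεj : ε j ≠ 0 := by obtain h | h := hε j <;> simp [h]
  rw [Bool.eq_iff_iff, submatrix_apply, sparsityMatrix_eq_true_iff, sparsityMatrix_eq_true_iff,
    mul_diagonal_mul_permMatrix_apply]
  simp [hεj]

theorem isUnorderedGLT_of_mem_Theta (hβ : β ∈ Theta δ) : IsUnorderedGLT β := by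
  obtain ⟨ρ, hρ⟩ := exists_perm_eq_submatrix_sparsityMatrix hβ
  obtain ⟨A, ⟨-, l, hl, hlA⟩, rfl, -⟩ := hβ
  refine isUnorderedGLT_of_isPivotRow (hl.comp ρ.symm.injective) fun j => ?_
  have hj := isPivotRow_iff_sparsityMatrix.mp (hlA (ρ.symm j))
  simp only [hρ, submatrix_apply, id, Equiv.apply_symm_apply] at hj
  exact isPivotRow_iff_sparsityMatrix.mpr hj

theorem mem_Theta_sparsityMatrix (hβ : IsUnorderedGLT β) : β ∈ Theta (sparsityMatrix β) :=
  ⟨β, hβ, rfl, fun _ => 1, 1, fun _ => Or.inl rfl, by simp [Equiv.Perm.permMatrix]⟩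

theorem sparsityMatrix_fillIn {x : {p : Fin m × Fin r // δ p.1 p.2 = true} → ℝ}
    (hx : ∀ p, x p ≠ 0) : sparsityMatrix (fillIn δ x) = δ := by
  ext i j
  rw [Bool.eq_iff_iff, sparsityMatrix_eq_true_iff, fillIn]
  split_ifs with h <;> simp [h, hx]

theorem fillIn_mem_Theta (hδ : IsUnorderedGLTSparsity δ)
    {x : {p : Fin m × Fin r // δ p.1 p.2 = true} → ℝ} (hx : ∀ p, x p ≠ 0) :
    fillIn δ x ∈ Theta δ := by
  obtain ⟨β, hβ, rfl⟩ := hδ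
  have hfill := sparsityMatrix_fillIn hx
  simpa only [hfill] using mem_Theta_sparsityMatrix (hβ.of_sparsityMatrix_eq hfill)

theorem exists_finset_card_eq_nonzeroRows (δ : Matrix (Fin m) (Fin r) Bool)
    (J : Finset (Fin r)) : ∃ R : Finset (Fin m),
      R.card = nonzeroRows δ J ∧ ∀ i, i ∈ R ↔ ∃ j ∈ J, δ i j = true :=
  ⟨_, rfl, fun i => by simp⟩

theorem nonzeroRows_submatrix (δ : Matrix (Fin m) (Fin r) Bool) (ρ : Equiv.Perm (Fin r))
    (J : Finset (Fin r)) :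
    nonzeroRows (δ.submatrix id ρ) J = nonzeroRows δ (J.map ρ.toEmbedding) := by
  obtain ⟨R, hRcard, hR⟩ := exists_finset_card_eq_nonzeroRows (δ.submatrix id ρ) J
  obtain ⟨R', hRcard', hR'⟩ := exists_finset_card_eq_nonzeroRows δ (J.map ρ.toEmbedding)
  have hRR' : R = R' := Finset.ext fun i => by
    simp only [hR, hR', submatrix_apply, id, Finset.mem_map, Equiv.coe_toEmbedding,
      exists_exists_and_eq_and]
  rw [← hRcard, ← hRcard', hRR']

theorem CountingRule.submatrix {s : ℕ} (h : CountingRule δ s) (ρ : Equiv.Perm (Fin r)) :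
    CountingRule (δ.submatrix id ρ) s := fun J hJ => by
  simpa [nonzeroRows_submatrix] using h (J.map ρ.toEmbedding) hJ.map

theorem RowDeletionProperty.submatrix (h : RowDeletionProperty β) (ρ : Equiv.Perm (Fin r)) :
    RowDeletionProperty (β.submatrix id ρ) := fun i => by
  have hrank (U : Finset (Fin m)) :
      ((β.submatrix id ρ).submatrix (fun k : U => (k : Fin m)) id).rank =
        (β.submatrix (fun k : U => (k : Fin m)) id).rank :=
    rank_submatrix (β.submatrix (fun k : U => (k : Fin m)) id) (Equiv.refl _) ρ
  simpa only [hrank] using h i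

end Sparsity

section CountingRuleNecessity

theorem card_le_card_inter_of_rank_submatrix_eq_card {K ι κ : Type*} [Field K] [DecidableEq ι]
    [Fintype κ] {A : Matrix ι κ K} {S R : Finset ι} {J : Finset κ}
    (hS : (A.submatrix (fun k : S => (k : ι)) id).rank = Fintype.card κ)
    (hR : ∀ i, ∀ j ∈ J, A i j ≠ 0 → i ∈ R) : J.card ≤ (S ∩ R).card := by
  let C : Matrix S J K := A.submatrix (fun k => (k : ι)) (fun j => (j : κ))
  have hC : C.rank = J.card := by
    have hcol := mulVec_injective_iff.mp (rank_eq_card_iff_mulVec_injective.mp hS)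
    have hinj := mulVec_injective_iff.mpr (hcol.comp (fun j : J => (j : κ)) Subtype.val_injective)
    simpa using (rank_eq_card_iff_mulVec_injective (A := C)).mpr hinj
  have hsupp : C.row.support ⊆ (R.subtype (· ∈ S) : Finset S) := by
    intro i hi
    obtain ⟨j, hj⟩ := Function.ne_iff.mp hi
    simpa using hR i j j.2 hj
  calc J.card = C.rank := hC.symm
    _ ≤ (R.subtype (· ∈ S)).card := rank_le_card_of_support_subset C _ hsupp
    _ = (S ∩ R).card := by rw [Finset.card_subtype, Finset.filter_mem_eq_inter, Finset.inter_comm]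

theorem RowDeletionProperty.countingRule {m r : ℕ} {β : Matrix (Fin m) (Fin r) ℝ}
    (h : RowDeletionProperty β) (hβ : ∀ j, ∃ i, β i j ≠ 0) :
    CountingRule (sparsityMatrix β) 1 := by
  rintro J ⟨j, hj⟩
  obtain ⟨i, hi⟩ := hβ j
  obtain ⟨S, T, hiS, hiT, hST, hS, hT⟩ := h i
  obtain ⟨R, hRcard, hR⟩ := exists_finset_card_eq_nonzeroRows (sparsityMatrix β) J
  have hsupp : ∀ i, ∀ j ∈ J, β i j ≠ 0 → i ∈ R := fun i j hj hij =>
    (hR i).mpr ⟨j, hj, sparsityMatrix_eq_true_iff.mpr hij⟩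
  have hcardS : J.card ≤ (S ∩ R).card :=
    card_le_card_inter_of_rank_submatrix_eq_card (by simpa using hS) hsupp
  have hcardT : J.card ≤ (T ∩ R).card :=
    card_le_card_inter_of_rank_submatrix_eq_card (by simpa using hT) hsupp
  have hdisj : Disjoint (S ∩ R) (T ∩ R) :=
    hST.mono Finset.inter_subset_left Finset.inter_subset_left
  have hi_notMem : i ∉ S ∩ R ∪ T ∩ R := by simp [hiS, hiT]
  calc 2 * J.card + 1 ≤ (S ∩ R).card + (T ∩ R).card + 1 := by omega
    _ = (insert i (S ∩ R ∪ T ∩ R)).card := by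
      rw [Finset.card_insert_of_notMem hi_notMem, Finset.card_union_of_disjoint hdisj]
    _ ≤ R.card := Finset.card_le_card <| Finset.insert_subset (hsupp i j hj hi) <|
      Finset.union_subset Finset.inter_subset_right Finset.inter_subset_right
    _ = nonzeroRows (sparsityMatrix β) J := hRcard

theorem RowDeletionProperty.countingRule_of_mem_Theta {m r : ℕ} {β : Matrix (Fin m) (Fin r) ℝ}
    {δ : Matrix (Fin m) (Fin r) Bool} (h : RowDeletionProperty β) (hβ : β ∈ Theta δ) :
    CountingRule δ 1 := by
  obtain ⟨-, l, -, hlβ⟩ := isUnorderedGLT_of_mem_Theta hβ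
  obtain ⟨ρ, rfl⟩ := exists_perm_eq_submatrix_sparsityMatrix hβ
  exact (h.countingRule fun j => ⟨l j, (hlβ j).2⟩).submatrix ρ

end CountingRuleNecessity

section GenericSufficiency

theorem exists_injective_of_card_mul_card_le_card_biUnion {κ ν α : Type*} [Fintype ν]
    [DecidableEq α] (t : κ → Finset α)
    (h : ∀ J : Finset κ, Fintype.card ν * J.card ≤ (J.biUnion t).card) :
    ∃ f : κ × ν → α, Function.Injective f ∧ ∀ x, f x ∈ t x.1 := by
  classical
  refine (Finset.all_card_le_biUnion_card_iff_exists_injective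
    fun x : κ × ν => t x.1).mp fun s => ?_
  calc s.card ≤ (s.image Prod.fst ×ˢ (Finset.univ : Finset ν)).card := Finset.card_le_card
        fun x hx => Finset.mem_product.mpr ⟨Finset.mem_image_of_mem _ hx, Finset.mem_univ _⟩
    _ = Fintype.card ν * (s.image Prod.fst).card := by
      rw [Finset.card_product, Finset.card_univ, mul_comm]
    _ ≤ ((s.image Prod.fst).biUnion t).card := h _
    _ = (s.biUnion fun x => t x.1).card := by rw [Finset.image_biUnion]

variable {m r : ℕ} {δ : Matrix (Fin m) (Fin r) Bool}

theorem CountingRule.exists_injective (h : CountingRule δ 1) (i : Fin m) :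
    ∃ f : Fin r × Bool → Fin m, Function.Injective f ∧ ∀ x, f x ≠ i ∧ δ (f x) x.1 = true := by
  classical
  let t (j : Fin r) : Finset (Fin m) := {k | k ≠ i ∧ δ k j = true}
  obtain ⟨f, hf, hft⟩ := exists_injective_of_card_mul_card_le_card_biUnion (ν := Bool) t fun J => by
    obtain rfl | hJ := J.eq_empty_or_nonempty
    · simp
    obtain ⟨R, hRcard, hR⟩ := exists_finset_card_eq_nonzeroRows δ J
    have ht : J.biUnion t = R.erase i := by
      ext k
      simp only [Finset.mem_biUnion, Finset.mem_filter_univ, Finset.mem_erase, hR, t]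
      tauto
    calc Fintype.card Bool * J.card = 2 * J.card := by rw [Fintype.card_bool]
      _ ≤ R.card - 1 := Nat.le_sub_of_add_le (hRcard ▸ h J hJ)
      _ ≤ (J.biUnion t).card := ht ▸ Finset.pred_card_le_card_erase
  exact ⟨f, hf, fun x => by simpa [t] using hft x⟩

theorem continuous_fillIn (δ : Matrix (Fin m) (Fin r) Bool) : Continuous (fillIn δ) := by
  refine continuous_pi fun i => continuous_pi fun j => ?_
  unfold fillIn
  split_ifs <;> fun_prop

-- Along the direction of the matched entries the minor is, up to the sign of its argument, a
-- characteristic polynomial, so almost every point of each such line avoids its zeros.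
theorem ae_det_submatrix_fillIn_ne_zero {f : Fin r → Fin m} (hf : Function.Injective f)
    (hδ : ∀ j, δ (f j) j = true) :
    ∀ᵐ x : {p : Fin m × Fin r // δ p.1 p.2 = true} → ℝ,
      ((fillIn δ x).submatrix f id).det ≠ 0 := by
  classical
  let v : {p : Fin m × Fin r // δ p.1 p.2 = true} → ℝ := fun p => if p.1.1 = f p.1.2 then 1 else 0
  have hopen : IsOpen {x | ((fillIn δ x).submatrix f id).det ≠ 0} :=
    isOpen_ne_fun (((continuous_fillIn δ).matrix_submatrix f id).matrix_det) continuous_const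
  refine ae_mem_of_ae_add_linearMap_mem (LinearMap.toSpanSingleton ℝ _ v) volume volume
    hopen.measurableSet fun y => ?_
  set A := (fillIn δ y).submatrix f id with hA
  have hline : ∀ t : ℝ, (fillIn δ (y + t • v)).submatrix f id = scalar (Fin r) t - -A := by
    intro t
    ext a b
    obtain rfl | hab := eq_or_ne a b
    · simp [hA, fillIn, v, hδ, add_comm]
    · have hfab : f a ≠ f b := hf.ne hab
      by_cases h : δ (f a) b = true <;> simp [hA, fillIn, v, h, hab, hfab]
  have hfin : {t : ℝ | (-A).charpoly.IsRoot t}.Finite :=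
    Polynomial.finite_setOfPred_isRoot (charpoly_monic _).ne_zero
  filter_upwards [compl_mem_ae_iff.mpr (hfin.measure_zero volume)] with t ht
  change ((fillIn δ (y + t • v)).submatrix f id).det ≠ 0
  rwa [hline, ← eval_charpoly]

theorem rowDeletionProperty_of_det_ne_zero {β : Matrix (Fin m) (Fin r) ℝ}
    (f : Fin m → Fin r × Bool → Fin m) (hf : ∀ i, Function.Injective (f i))
    (hfi : ∀ i x, f i x ≠ i) (hdet : ∀ i b, (β.submatrix (fun j => f i (j, b)) id).det ≠ 0) :
    RowDeletionProperty β := by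
  classical
  intro i
  let rows (b : Bool) : Finset (Fin m) := Finset.univ.image fun j => f i (j, b)
  have hi (b : Bool) : i ∉ rows b := by simp [rows, hfi]
  have hrank (b : Bool) : (β.submatrix (fun k : rows b => (k : Fin m)) id).rank = r := by
    have hinj : Function.Injective (β.submatrix (fun k : rows b => (k : Fin m)) id).mulVec := by
      refine fun v w hvw => mulVec_injective_of_isUnit
        ((isUnit_iff_isUnit_det _).mpr (hdet i b).isUnit) (funext fun j => ?_)
      exact congrFun hvw ⟨f i (j, b), Finset.mem_image_of_mem _ (Finset.mem_univ j)⟩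
    simpa using rank_eq_card_iff_mulVec_injective.mpr hinj
  refine ⟨rows true, rows false, hi true, hi false, ?_, hrank true, hrank false⟩
  simp [rows, Finset.disjoint_left, (hf i).eq_iff]

theorem CountingRule.isNullInTheta_not_rowDeletionProperty (h : CountingRule δ 1) :
    IsNullInTheta δ {β | ¬ RowDeletionProperty β} := by
  choose f hf hfδ using h.exists_injective
  have hdet : ∀ᵐ x : {p : Fin m × Fin r // δ p.1 p.2 = true} → ℝ,
      ∀ i b, ((fillIn δ x).submatrix (fun j => f i (j, b)) id).det ≠ 0 :=
    ae_all_iff.mpr fun i => ae_all_iff.mpr fun b => ae_det_submatrix_fillIn_ne_zero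
      ((hf i).comp (Prod.mk_left_injective b)) fun j => (hfδ i (j, b)).2
  refine fun ρ => ae_iff.mp ?_
  filter_upwards [hdet] with x hx
  exact (rowDeletionProperty_of_det_ne_zero f hf (fun i x => (hfδ i x).1) hx).submatrix ρ

theorem IsNullInTheta.exists_mem_Theta_notMem (hδ : IsUnorderedGLTSparsity δ)
    {N : Set (Matrix (Fin m) (Fin r) ℝ)} (hN : IsNullInTheta δ N) : ∃ β ∈ Theta δ, β ∉ N := by
  have hfill : ∀ᵐ x : {p : Fin m × Fin r // δ p.1 p.2 = true} → ℝ, fillIn δ x ∉ N :=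
    ae_iff.mpr (by simpa using hN 1)
  have hne : ∀ᵐ x : {p : Fin m × Fin r // δ p.1 p.2 = true} → ℝ, ∀ p, x p ≠ 0 :=
    ae_all_iff.mpr fun p => Measure.ae_eval_ne (μ := fun _ => volume) p 0
  obtain ⟨x, hxN, hx⟩ := (hfill.and hne).exists
  exact ⟨fillIn δ x, fillIn_mem_Theta hδ hx, hxN⟩

end GenericSufficiency

section GramSchmidt

open InnerProductSpace

variable {𝕜 E ι κ : Type*} [RCLike 𝕜] [NormedAddCommGroup E] [InnerProductSpace 𝕜 E]
  [LinearOrder ι] [LocallyFiniteOrderBot ι] [WellFoundedLT ι]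

theorem inner_gramSchmidtNormed_of_lt (f : ι → E) {i n : ι} (h : i < n) :
    inner 𝕜 (gramSchmidtNormed 𝕜 f n) (f i) = 0 := by
  rw [gramSchmidtNormed, inner_smul_left, gramSchmidt_inv_triangular 𝕜 f h, mul_zero]

theorem inner_gramSchmidtNormed_self_ne_zero {f : ι → E} {n : ι}
    (h : gramSchmidtNormed 𝕜 f n ≠ 0) : inner 𝕜 (gramSchmidtNormed 𝕜 f n) (f n) ≠ 0 := by
  have hg : gramSchmidt 𝕜 f n ≠ 0 := fun h0 => h (by rw [gramSchmidtNormed, h0, smul_zero])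
  have hinner : inner 𝕜 (gramSchmidt 𝕜 f n) (f n) =
      inner 𝕜 (gramSchmidt 𝕜 f n) (gramSchmidt 𝕜 f n) := by
    conv_lhs => rw [gramSchmidt_def'' 𝕜 f n]
    rw [inner_add_right, inner_sum, Finset.sum_eq_zero fun i hi => ?_, add_zero]
    rw [inner_smul_right, gramSchmidt_orthogonal 𝕜 f (Finset.mem_Iio.mp hi).ne', mul_zero]
  rw [gramSchmidtNormed, inner_smul_left, hinner]
  simpa using hg

theorem exists_orthonormalBasis_inner_eq_zero_of_lt [Finite ι] [Fintype κ] {f : ι → E}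
    (hf : Submodule.span 𝕜 (Set.range f) = ⊤) (hκ : Module.finrank 𝕜 E = Fintype.card κ) :
    ∃ (b : OrthonormalBasis κ 𝕜 E) (l : κ → ι), Function.Injective l ∧
      ∀ j, (∀ i < l j, inner 𝕜 (b j) (f i) = 0) ∧ inner 𝕜 (b j) (f (l j)) ≠ 0 := by
  classical
  cases nonempty_fintype ι
  have hrange : Submodule.span 𝕜
      (Set.range fun i : {i | gramSchmidtNormed 𝕜 f i ≠ 0} => gramSchmidtNormed 𝕜 f i) = ⊤ := by
    rw [← hf, ← span_gramSchmidt 𝕜 f, ← span_gramSchmidtNormed_range]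
    refine le_antisymm (Submodule.span_mono (by rintro _ ⟨i, rfl⟩; exact ⟨i, rfl⟩)) ?_
    rw [← Submodule.span_sdiff_singleton_zero]
    refine Submodule.span_mono ?_
    rintro _ ⟨⟨i, rfl⟩, hi⟩
    exact ⟨⟨i, hi⟩, rfl⟩
  let b := OrthonormalBasis.mk (gramSchmidtNormed_orthonormal' f) hrange.ge
  let e : {i | gramSchmidtNormed 𝕜 f i ≠ 0} ≃ κ := Fintype.equivOfCardEq <| by
    rw [← Module.finrank_eq_card_basis b.toBasis, hκ]
  have hb : ∀ j, b.reindex e j = gramSchmidtNormed 𝕜 f (e.symm j) := fun j => by simp [b]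
  refine ⟨b.reindex e, fun j => e.symm j, Subtype.val_injective.comp e.symm.injective,
    fun j => ⟨fun i hi => ?_, ?_⟩⟩
  · rw [hb, inner_gramSchmidtNormed_of_lt f hi]
  · rw [hb]
    exact inner_gramSchmidtNormed_self_ne_zero (e.symm j).2

end GramSchmidt

section Rotation

theorem span_range_toLp_row_eq_top {ι κ : Type*} [Fintype κ] {A : Matrix ι κ ℝ}
    (hA : A.rank = Fintype.card κ) :
    Submodule.span ℝ (Set.range fun i => (WithLp.toLp 2 (A i) : EuclideanSpace ℝ κ)) = ⊤ := by
  rw [← Submodule.orthogonal_eq_bot_iff, Submodule.eq_bot_iff]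
  intro v hv
  have hAv : A *ᵥ v.ofLp = A *ᵥ 0 := by
    rw [mulVec_zero]
    ext i
    have := (Submodule.mem_orthogonal _ v).mp hv _ (Submodule.subset_span ⟨i, rfl⟩)
    simpa [PiLp.inner_apply, mulVec, dotProduct, mul_comm] using this
  exact (WithLp.ofLp_eq_zero 2).mp (rank_eq_card_iff_mulVec_injective.mp hA hAv)

theorem exists_isUnorderedGLT_mul_transpose_eq {m r : ℕ} {A : Matrix (Fin m) (Fin r) ℝ}
    (hA : A.rank = r) : ∃ B : Matrix (Fin m) (Fin r) ℝ, IsUnorderedGLT B ∧ B * Bᵀ = A * Aᵀ := by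
  let a (i : Fin m) : EuclideanSpace ℝ (Fin r) := WithLp.toLp 2 (A i)
  obtain ⟨b, l, hl, hb⟩ := exists_orthonormalBasis_inner_eq_zero_of_lt (κ := Fin r)
    (span_range_toLp_row_eq_top (A := A) (by simpa using hA)) (by simp)
  refine ⟨of fun i j => inner ℝ (b j) (a i), isUnorderedGLT_of_isPivotRow hl hb, ?_⟩
  ext i k
  calc ∑ j, inner ℝ (b j) (a i) * inner ℝ (b j) (a k)
      = ∑ j, inner ℝ (a i) (b j) * inner ℝ (b j) (a k) := by simp only [real_inner_comm]
    _ = inner ℝ (a i) (a k) := b.sum_inner_mul_inner (a i) (a k)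
    _ = (A * Aᵀ) i k := by simp [a, PiLp.inner_apply, mul_apply, mul_comm]

end Rotation

section Deformation

open Filter Topology MatrixOrder

section Gram

variable {ι κ : Type*} [Finite ι] [Fintype κ]

theorem eventually_rank_eq_card_of_mul_transpose_eq {β : Matrix ι κ ℝ}
    (hβ : β.rank = Fintype.card κ) :
    ∀ᶠ G in 𝓝 (β * βᵀ), ∀ A : Matrix ι κ ℝ, A * Aᵀ = G → A.rank = Fintype.card κ := by
  classical
  cases nonempty_fintype ι
  obtain ⟨L, hL⟩ := rank_eq_card_iff_exists_mul_eq_one.mp hβ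
  have hgram : ∀ A : Matrix ι κ ℝ, L * (A * Aᵀ) * Lᵀ = L * A * (L * A)ᵀ := fun A => by
    simp only [transpose_mul, Matrix.mul_assoc]
  have hcont : Continuous fun G : Matrix ι ι ℝ => (L * G * Lᵀ).det := by fun_prop
  have hdet : ∀ᶠ G in 𝓝 (β * βᵀ), (L * G * Lᵀ).det ≠ 0 :=
    hcont.continuousAt.eventually_ne (by simp [hgram, hL])
  filter_upwards [hdet] with G hG A hA
  have hunit : IsUnit (L * A).det := isUnit_iff_ne_zero.mpr fun h0 => hG <| by
    rw [← hA, hgram, det_mul, h0, zero_mul]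
  refine rank_eq_card_iff_exists_mul_eq_one.mpr ⟨(L * A)⁻¹ * L, ?_⟩
  rw [Matrix.mul_assoc, nonsing_inv_mul _ hunit]

end Gram

variable {m r : ℕ} {β : Matrix (Fin m) (Fin r) ℝ} {σ : Fin m → ℝ}

theorem VarianceIdentified.eventually_gram_eq (hvar : VarianceIdentified β σ) (hβ : β.rank = r)
    (hσ : ∀ i, 0 < σ i) : ∀ᶠ G in 𝓝 (β * βᵀ),
      (∃ A : Matrix (Fin m) (Fin r) ℝ, A * Aᵀ = G) →
      (∀ i k, i ≠ k → G i k = (β * βᵀ) i k) → G = β * βᵀ := by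
  have hrank := eventually_rank_eq_card_of_mul_transpose_eq (β := β) (by simpa using hβ)
  have hpos : ∀ᶠ G in 𝓝 (β * βᵀ), ∀ i, 0 < σ i + (β * βᵀ) i i - G i i :=
    eventually_all.mpr fun i => by
      have hcont : Continuous fun G : Matrix (Fin m) (Fin m) ℝ => σ i + (β * βᵀ) i i - G i i := by
        fun_prop
      exact hcont.continuousAt.eventually_const_lt (by simpa using hσ i)
  filter_upwards [hrank, hpos] with G hG hGσ
  rintro ⟨A, rfl⟩ hoff
  obtain ⟨B, hB, hBA⟩ := exists_isUnorderedGLT_mul_transpose_eq (by simpa using hG A rfl)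
  refine hBA ▸ (hvar B _ ⟨hB, hGσ, ?_⟩).2
  rw [hBA]
  ext i k
  obtain rfl | hik := eq_or_ne i k
  · simp [add_comm]
  · simp [hik, hoff i k hik]

theorem eventually_posDef_of_isSymm {κ : Type*} [Finite κ] [DecidableEq κ] :
    ∀ᶠ W in 𝓝 (1 : Matrix κ κ ℝ), W.IsSymm → W.PosDef := by
  cases nonempty_fintype κ
  have hdom : ∀ᶠ W in 𝓝 (1 : Matrix κ κ ℝ),
      ∀ k, 0 < W k k - ∑ j ∈ Finset.univ.erase k, ‖W k j‖ := eventually_all.mpr fun k => by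
    have hcont : Continuous fun W : Matrix κ κ ℝ =>
        W k k - ∑ j ∈ Finset.univ.erase k, ‖W k j‖ := by fun_prop
    refine hcont.continuousAt.eventually_const_lt ?_
    have hsum : ∑ j ∈ Finset.univ.erase k, ‖(1 : Matrix κ κ ℝ) k j‖ = 0 :=
      Finset.sum_eq_zero fun j hj => by simp [(Finset.ne_of_mem_erase hj).symm]
    simp only [hsum, one_apply_eq, sub_zero, zero_lt_one]
  filter_upwards [hdom] with W hW hsymm
  have hherm : W.IsHermitian := hsymm
  refine hherm.posDef_iff_eigenvalues_pos.mpr fun i => ?_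
  have heigen : Module.End.HasEigenvalue (toLin' W) (hherm.eigenvalues i) := by
    rw [Module.End.hasEigenvalue_iff_mem_spectrum, spectrum_toLin']
    exact hherm.eigenvalues_mem_spectrum_real i
  obtain ⟨k, hk⟩ := eigenvalue_mem_ball heigen
  rw [Real.closedBall_eq_Icc] at hk
  linarith [hk.1, hW k]

/-- The deformation of the Gram matrix `β βᵀ` in which the rows of `β` in `X` are paired by `W`, the
other rows by `W⁻¹`, and the products of a row in `X` with a row outside are left unchanged. It is
again a Gram matrix when `W = C Cᵀ`, because then the two kinds of rows can be multiplied by `C` and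
by `C⁻ᵀ`. -/
noncomputable def twistedGram {ι κ : Type*} [DecidableEq ι] [Fintype κ] [DecidableEq κ]
    (X : Finset ι) (β : Matrix ι κ ℝ) (W : Matrix κ κ ℝ) : Matrix ι ι ℝ :=
  of fun i k => if i ∈ X then if k ∈ X then (β * W * βᵀ) i k else (β * βᵀ) i k
    else if k ∈ X then (β * βᵀ) i k else (β * W⁻¹ * βᵀ) i k

section TwistedGram

variable {ι κ : Type*} [DecidableEq ι] [Fintype κ] [DecidableEq κ] (X : Finset ι)
  (β : Matrix ι κ ℝ)

theorem tendsto_twistedGram : Tendsto (twistedGram X β) (𝓝 1) (𝓝 (β * βᵀ)) := by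
  have hone : twistedGram X β 1 = β * βᵀ := by
    ext i k
    simp [twistedGram]
  have hinv : ContinuousAt (fun W : Matrix κ κ ℝ => W⁻¹) 1 :=
    continuousAt_matrix_inv _ (by simp)
  rw [← hone]
  refine continuousAt_pi.mpr fun i => continuousAt_pi.mpr fun k => ?_
  unfold twistedGram
  simp only [of_apply]
  have hW : Continuous fun W : Matrix κ κ ℝ => (β * W * βᵀ) i k := by fun_prop
  split_ifs
  · exact hW.continuousAt
  · exact continuousAt_const
  · exact continuousAt_const
  · exact hW.continuousAt.comp hinv

theorem exists_mul_transpose_eq_twistedGram {W : Matrix κ κ ℝ} (hW : W.PosDef) :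
    ∃ A : Matrix ι κ ℝ, A * Aᵀ = twistedGram X β W := by
  obtain ⟨C, hC⟩ := CStarAlgebra.nonneg_iff_eq_mul_star_self.mp hW.posSemidef.nonneg
  replace hC : W = C * Cᵀ := hC
  have hCdet : IsUnit C.det := isUnit_iff_ne_zero.mpr fun h0 => hW.det_pos.ne' (by simp [hC, h0])
  have hprod (P Q : Matrix κ κ ℝ) (i k : ι) :
      (β * P) i ⬝ᵥ (β * Q) k = (β * (P * Qᵀ) * βᵀ) i k := by
    have hassoc : β * (P * Qᵀ) * βᵀ = β * P * (β * Q)ᵀ := by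
      simp only [transpose_mul, Matrix.mul_assoc]
    rw [hassoc, mul_apply']
    rfl
  refine ⟨of fun i => if i ∈ X then (β * C) i else (β * C⁻¹ᵀ) i, ?_⟩
  ext i k
  rw [mul_apply']
  change (if i ∈ X then (β * C) i else (β * C⁻¹ᵀ) i) ⬝ᵥ
    (if k ∈ X then (β * C) k else (β * C⁻¹ᵀ) k) = _
  by_cases hi : i ∈ X <;> by_cases hk : k ∈ X <;>
    simp only [twistedGram, of_apply, hi, hk, if_true, if_false, hprod, transpose_transpose, hC,
      mul_nonsing_inv _ hCdet, Matrix.mul_inv_rev, transpose_nonsing_inv, Matrix.mul_one,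
      nonsing_inv_mul _ (isUnit_det_transpose C hCdet)]

end TwistedGram

end Deformation

section RankTwo

open Filter Topology

theorem one_add_smul_vecMulVec_inv {κ : Type*} [Fintype κ] [DecidableEq κ] (u v : κ → ℝ)
    {h k Δ : ℝ} (hΔ : Δ = 1 + h * (u ⬝ᵥ u) + k * (v ⬝ᵥ v) +
      h * k * ((u ⬝ᵥ u) * (v ⬝ᵥ v) - (u ⬝ᵥ v) ^ 2)) (hΔ0 : Δ ≠ 0) :
    (1 + h • vecMulVec u u + k • vecMulVec v v)⁻¹ =
      1 - Δ⁻¹ • (h • vecMulVec u u + k • vecMulVec v v +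
        (h * k) • ((v ⬝ᵥ v) • vecMulVec u u - (u ⬝ᵥ v) • (vecMulVec u v + vecMulVec v u) +
          (u ⬝ᵥ u) • vecMulVec v v)) := by
  set A := h • vecMulVec u u + k • vecMulVec v v with hA
  set B := A + (h * k) • ((v ⬝ᵥ v) • vecMulVec u u -
    (u ⬝ᵥ v) • (vecMulVec u v + vecMulVec v u) + (u ⬝ᵥ u) • vecMulVec v v) with hB
  have hAB : B + A * B = Δ • A := by
    simp only [hB, hA, hΔ, Matrix.mul_add, Matrix.add_mul, Matrix.mul_sub, Matrix.mul_smul,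
      Matrix.smul_mul, vecMulVec_mul_vecMulVec, vecMulVec_smul, dotProduct_comm v u]
    module
  refine inv_eq_right_inv ?_
  calc (1 + h • vecMulVec u u + k • vecMulVec v v) * (1 - Δ⁻¹ • B)
      = 1 + A - Δ⁻¹ • (B + A * B) := by
        rw [add_assoc, ← hA, Matrix.mul_sub, Matrix.mul_smul, Matrix.mul_one, Matrix.add_mul,
          Matrix.one_mul]
    _ = 1 := by rw [hAB, inv_smul_smul₀ hΔ0, add_sub_cancel_right]

variable {m r : ℕ} {β : Matrix (Fin m) (Fin r) ℝ} {σ : Fin m → ℝ}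

theorem VarianceIdentified.eventually_twistedGram_eq (hvar : VarianceIdentified β σ)
    (hβ : β.rank = r) (hσ : ∀ i, 0 < σ i) (X : Finset (Fin m)) :
    ∀ᶠ W in 𝓝 (1 : Matrix (Fin r) (Fin r) ℝ), W.IsSymm →
      (∀ i k, i ≠ k → twistedGram X β W i k = (β * βᵀ) i k) → twistedGram X β W = β * βᵀ := by
  filter_upwards [(tendsto_twistedGram X β).eventually (hvar.eventually_gram_eq hβ hσ),
    eventually_posDef_of_isSymm] with W hgram hpos hW hoff
  exact hgram (exists_mul_transpose_eq_twistedGram X β (hpos hW)) hoff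

theorem VarianceIdentified.eventually_sq_add_sq_eq_zero (hvar : VarianceIdentified β σ)
    (hβ : β.rank = r) (hσ : ∀ i, 0 < σ i) (X : Finset (Fin m)) (u v : Fin r → ℝ)
    {f g : Fin m → ℝ} (hf : f = β *ᵥ u) (hg : g = β *ᵥ v) :
    ∀ᶠ p in 𝓝 (0 : ℝ × ℝ),
      (∀ i ∈ X, ∀ l ∈ X, i ≠ l → p.1 * (f i * f l) + p.2 * (g i * g l) = 0) →
      (∀ i ∉ X, ∀ l ∉ X, i ≠ l → p.1 * (f i * f l) + p.2 * (g i * g l) + p.1 * p.2 *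
        ((v ⬝ᵥ v) * (f i * f l) - (u ⬝ᵥ v) * (f i * g l + g i * f l) +
          (u ⬝ᵥ u) * (g i * g l)) = 0) →
      ∀ i ∈ X, p.1 * f i ^ 2 + p.2 * g i ^ 2 = 0 := by
  let W (p : ℝ × ℝ) : Matrix (Fin r) (Fin r) ℝ :=
    1 + p.1 • vecMulVec u u + p.2 • vecMulVec v v
  have hWcont : Tendsto W (𝓝 0) (𝓝 1) := by
    have : Continuous W := by fun_prop
    simpa [W] using this.tendsto 0
  have hdet : ∀ᶠ p : ℝ × ℝ in 𝓝 0, 1 + p.1 * (u ⬝ᵥ u) + p.2 * (v ⬝ᵥ v) +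
      p.1 * p.2 * ((u ⬝ᵥ u) * (v ⬝ᵥ v) - (u ⬝ᵥ v) ^ 2) ≠ 0 :=
    ContinuousAt.eventually_ne (by fun_prop) (by simp)
  have hrankOne (x y : Fin r → ℝ) : β * vecMulVec x y * βᵀ = vecMulVec (β *ᵥ x) (β *ᵥ y) := by
    rw [mul_vecMulVec, vecMulVec_mul, vecMul_transpose]
  filter_upwards [hWcont.eventually (hvar.eventually_twistedGram_eq hβ hσ X), hdet]
    with p hp hΔ hin hout i hi
  have hinner : β * W p * βᵀ = β * βᵀ + (p.1 • vecMulVec f f + p.2 • vecMulVec g g) := by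
    simp only [W, Matrix.mul_add, Matrix.add_mul, Matrix.mul_smul, Matrix.smul_mul, hrankOne,
      Matrix.mul_one, ← hf, ← hg, add_assoc]
  have hsymm : (W p).IsSymm := by
    simp [W, IsSymm, transpose_add, transpose_vecMulVec]
  have houter := congr(β * $(one_add_smul_vecMulVec_inv u v rfl hΔ) * βᵀ)
  simp only [Matrix.mul_add, Matrix.add_mul, Matrix.mul_sub, Matrix.sub_mul, Matrix.mul_smul,
    Matrix.smul_mul, hrankOne, Matrix.mul_one, ← hf, ← hg] at houter
  have heq := hp hsymm fun a b hab => by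
    by_cases ha : a ∈ X <;> by_cases hb : b ∈ X
    · simpa [twistedGram, ha, hb, hinner, vecMulVec_apply] using hin a ha b hb hab
    · simp [twistedGram, ha, hb]
    · simp [twistedGram, ha, hb]
    · have hzero := hout a ha b hb hab
      simp only [twistedGram, of_apply, ha, hb, if_false, W, houter, Matrix.sub_apply,
        Matrix.add_apply, Matrix.smul_apply, smul_eq_mul, vecMulVec_apply, hzero,
        mul_zero, sub_zero]
  simpa [twistedGram, hi, hinner, vecMulVec_apply, sq] using congr_fun (congr_fun heq i) i

end RankTwo

section SmallSupports

open Filter Topology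

variable {m r : ℕ} {β : Matrix (Fin m) (Fin r) ℝ} {σ : Fin m → ℝ}

theorem frequently_ne_zero_and_bilinear_eq_zero (a b c : ℝ) :
    ∃ᶠ p in 𝓝 (0 : ℝ × ℝ), p ≠ 0 ∧ a * p.1 + b * p.2 + c * (p.1 * p.2) = 0 := by
  have hpunctured : ∃ᶠ t in 𝓝 (0 : ℝ), t ≠ 0 :=
    mem_closure_iff_frequently.mp (closure_compl_singleton (0 : ℝ) ▸ Set.mem_univ _)
  by_cases hb : b = 0
  · have hline : Tendsto (fun t : ℝ => ((0 : ℝ), t)) (𝓝 0) (𝓝 0) :=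
      Continuous.tendsto' (by fun_prop) _ _ rfl
    exact hline.frequently <| hpunctured.mono fun t ht => ⟨by simpa using ht, by simp [hb]⟩
  · have hcurve : Tendsto (fun t : ℝ => (t, -(a * t) / (b + c * t))) (𝓝 0) (𝓝 0) := by
      have : ContinuousAt (fun t : ℝ => (t, -(a * t) / (b + c * t))) 0 := by
        fun_prop (disch := simpa using hb)
      simpa [ContinuousAt, Prod.zero_eq_mk] using this
    have hden : ∀ᶠ t in 𝓝 (0 : ℝ), b + c * t ≠ 0 :=
      ContinuousAt.eventually_ne (by fun_prop) (by simpa using hb)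
    refine hcurve.frequently <| (hpunctured.and_eventually hden).mono fun t ht => ⟨?_, ?_⟩
    · simp [ht.1]
    · linear_combination div_mul_cancel₀ (-(a * t)) ht.2

theorem VarianceIdentified.three_le_card (hvar : VarianceIdentified β σ) (hβ : β.rank = r)
    (hσ : ∀ i, 0 < σ i) {u : Fin r → ℝ} (hu : β *ᵥ u ≠ 0) {R : Finset (Fin m)}
    (hR : ∀ i ∉ R, (β *ᵥ u) i = 0) : 3 ≤ R.card := by
  by_contra! hcard
  obtain ⟨a, ha⟩ : ∃ a, (β *ᵥ u) a ≠ 0 := Function.ne_iff.mp hu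
  have haR : a ∈ R := by_contra fun h => ha (hR a h)
  have hrest : ∀ i ≠ a, ∀ l ≠ a, i ≠ l → (β *ᵥ u) i * (β *ᵥ u) l = 0 := by
    intro i hi l hl hil
    by_contra! hne
    have hsub : {a, i, l} ⊆ R := by
      have hiR : i ∈ R := by_contra fun h => hne (by simp [hR i h])
      have hlR : l ∈ R := by_contra fun h => hne (by simp [hR l h])
      simp [Finset.insert_subset_iff, haR, hiR, hlR]
    have hthree := Finset.card_eq_three.mpr ⟨a, i, l, hi.symm, hl.symm, hil, rfl⟩
    exact (hthree.symm.trans_le (Finset.card_le_card hsub)).not_gt hcard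
  obtain ⟨p, ⟨hp0, hp⟩, hzero⟩ := ((frequently_ne_zero_and_bilinear_eq_zero 0 1 0).and_eventually
    (hvar.eventually_sq_add_sq_eq_zero hβ hσ {a} u 0 rfl (g := 0) (by simp))).exists
  have h2 : p.2 = 0 := by simpa using hp
  specialize hzero (by simp) (fun i hi l hl hil => by
    simp [hrest i (by simpa using hi) l (by simpa using hl) hil])
  have h1 : p.1 = 0 := by simpa [ha] using hzero a (by simp)
  exact hp0 (Prod.ext h1 h2)

theorem VarianceIdentified.five_le_card (hvar : VarianceIdentified β σ) (hβ : β.rank = r)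
    (hσ : ∀ i, 0 < σ i) {u v : Fin r → ℝ} {x y : Fin m} (hux : (β *ᵥ u) x = 1)
    (huy : (β *ᵥ u) y = 0) (hvx : (β *ᵥ v) x = 0) (hvy : (β *ᵥ v) y = 1)
    {R : Finset (Fin m)} (hRu : ∀ i ∉ R, (β *ᵥ u) i = 0) (hRv : ∀ i ∉ R, (β *ᵥ v) i = 0) :
    5 ≤ R.card := by
  by_contra! hcard
  have hxy : x ≠ y := by
    rintro rfl
    exact one_ne_zero (hux.symm.trans huy)
  have hxR : x ∈ R := by_contra fun h => one_ne_zero (hux.symm.trans (hRu x h))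
  have hyR : y ∈ R := by_contra fun h => one_ne_zero (hvy.symm.trans (hRv y h))
  obtain ⟨k₀, l₀, hrest⟩ : ∃ k₀ l₀, R \ {x, y} ⊆ {k₀, l₀} := by
    have hle : (R \ {x, y}).card ≤ 2 := by
      have := Finset.card_sdiff_add_card_eq_card (s := {x, y}) (t := R) (by grind)
      have := Finset.card_pair hxy
      omega
    obtain ⟨T, hT, hTcard⟩ := Finset.exists_superset_card_eq hle
      ((Finset.card_pair hxy).symm.trans_le (Finset.card_le_univ {x, y}))
    obtain ⟨k₀, l₀, -, rfl⟩ := Finset.card_eq_two.mp hTcard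
    exact ⟨k₀, l₀, hT⟩
  generalize hf : β *ᵥ u = f at *
  generalize hg : β *ᵥ v = g at *
  obtain ⟨p, ⟨hp0, hp⟩, hzero⟩ := ((frequently_ne_zero_and_bilinear_eq_zero (f k₀ * f l₀)
    (g k₀ * g l₀) ((v ⬝ᵥ v) * (f k₀ * f l₀) - (u ⬝ᵥ v) * (f k₀ * g l₀ + g k₀ * f l₀) +
      (u ⬝ᵥ u) * (g k₀ * g l₀))).and_eventually
    (hvar.eventually_sq_add_sq_eq_zero hβ hσ {x, y} u v hf.symm hg.symm)).exists
  specialize hzero ?_ ?_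
  · simp [hux, huy, hvx, hvy, hxy]
  · intro i hi l hl hil
    by_cases hiR : i ∈ R
    · by_cases hlR : l ∈ R
      · have hi₀ := hrest (Finset.mem_sdiff.mpr ⟨hiR, hi⟩)
        have hl₀ := hrest (Finset.mem_sdiff.mpr ⟨hlR, hl⟩)
        simp only [Finset.mem_insert, Finset.mem_singleton] at hi₀ hl₀
        rcases hi₀ with rfl | rfl <;> rcases hl₀ with rfl | rfl
        · exact absurd rfl hil
        · linear_combination hp
        · linear_combination hp
        · exact absurd rfl hil
      · simp [hRu l hlR, hRv l hlR]
    · simp [hRu i hiR, hRv i hiR]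
  have h1 : p.1 = 0 := by simpa [hux, hvx] using hzero x (by simp)
  have h2 : p.2 = 0 := by simpa [huy, hvy] using hzero y (by simp)
  exact hp0 (Prod.ext h1 h2)

end SmallSupports

section CountingRuleOfVarianceIdentified

variable {m r : ℕ} {δ : Matrix (Fin m) (Fin r) Bool} {β : Matrix (Fin m) (Fin r) ℝ}
  {σ : Fin m → ℝ}

theorem IsUnorderedGLT.exists_dual_pair (hβ : IsUnorderedGLT β) {j₁ j₂ : Fin r} (hj : j₁ ≠ j₂) :
    ∃ (x y : Fin m) (a b c d : ℝ),
      (a • β.col j₁ + b • β.col j₂) x = 1 ∧ (a • β.col j₁ + b • β.col j₂) y = 0 ∧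
      (c • β.col j₁ + d • β.col j₂) x = 0 ∧ (c • β.col j₁ + d • β.col j₂) y = 1 := by
  obtain ⟨-, l, hl, hlβ⟩ := hβ
  have hx := (hlβ j₁).2
  have hy := (hlβ j₂).2
  refine ⟨l j₁, l j₂, ?_⟩
  obtain hlt | hlt := lt_or_gt_of_ne (hl.ne hj)
  · have hzero := (hlβ j₂).1 _ hlt
    refine ⟨(β (l j₁) j₁)⁻¹, -((β (l j₁) j₁)⁻¹ * β (l j₂) j₁ / β (l j₂) j₂), 0,
      (β (l j₂) j₂)⁻¹, ?_, ?_, ?_, ?_⟩ <;> simp [hx, hy, hzero]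
  · have hzero := (hlβ j₁).1 _ hlt
    refine ⟨(β (l j₁) j₁)⁻¹, 0, -((β (l j₂) j₂)⁻¹ * β (l j₁) j₂ / β (l j₁) j₁),
      (β (l j₂) j₂)⁻¹, ?_, ?_, ?_, ?_⟩ <;> simp [hx, hy, hzero]

theorem VarianceIdentified.two_mul_card_add_one_le_nonzeroRows (hvar : VarianceIdentified β σ)
    (hβ : IsUnorderedGLT β) (hσ : ∀ i, 0 < σ i) {J : Finset (Fin r)} (hJ : J.Nonempty)
    (hJ2 : J.card ≤ 2) : 2 * J.card + 1 ≤ nonzeroRows (sparsityMatrix β) J := by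
  obtain ⟨R, hRcard, hR⟩ := exists_finset_card_eq_nonzeroRows (sparsityMatrix β) J
  have hzero : ∀ i ∉ R, ∀ j ∈ J, β i j = 0 := fun i hi j hj => by_contra fun h =>
    hi ((hR i).mpr ⟨j, hj, sparsityMatrix_eq_true_iff.mpr h⟩)
  rw [← hRcard]
  obtain hcard | hcard : J.card = 1 ∨ J.card = 2 := by
    have := hJ.card_pos
    omega
  · obtain ⟨j, rfl⟩ := Finset.card_eq_one.mp hcard
    have hcol : β *ᵥ Pi.single j 1 = β.col j := mulVec_single_one β j
    have hne : β *ᵥ Pi.single j 1 ≠ 0 := by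
      obtain ⟨-, l, -, hlβ⟩ := hβ
      exact hcol ▸ fun h => (hlβ j).2 (congrFun h (l j))
    exact hvar.three_le_card hβ.1 hσ hne fun i hi => by rw [hcol, col_apply, hzero i hi j (by simp)]
  · obtain ⟨j₁, j₂, hj, rfl⟩ := Finset.card_eq_two.mp hcard
    obtain ⟨x, y, a, b, c, d, hux, huy, hvx, hvy⟩ := hβ.exists_dual_pair hj
    have hcomb (s t : ℝ) : β *ᵥ (s • Pi.single j₁ 1 + t • Pi.single j₂ 1) =
        s • β.col j₁ + t • β.col j₂ := by
      simp only [mulVec_add, mulVec_smul, mulVec_single_one]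
    have hsupp (s t : ℝ) : ∀ i ∉ R, (s • β.col j₁ + t • β.col j₂) i = 0 := fun i hi => by
      simp [hzero i hi j₁ (by simp), hzero i hi j₂ (by simp)]
    rw [← hcomb] at hux huy hvx hvy
    simp only [← hcomb] at hsupp
    rw [hcard]
    exact hvar.five_le_card hβ.1 hσ hux huy hvx hvy (hsupp a b) (hsupp c d)

theorem VarianceIdentified.two_mul_card_add_one_le_nonzeroRows_of_mem_Theta
    (hvar : VarianceIdentified β σ) (hβ : β ∈ Theta δ) (hσ : ∀ i, 0 < σ i) {J : Finset (Fin r)}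
    (hJ : J.Nonempty) (hJ2 : J.card ≤ 2) : 2 * J.card + 1 ≤ nonzeroRows δ J := by
  obtain ⟨ρ, rfl⟩ := exists_perm_eq_submatrix_sparsityMatrix hβ
  rw [nonzeroRows_submatrix, ← J.card_map ρ.toEmbedding]
  exact hvar.two_mul_card_add_one_le_nonzeroRows (isUnorderedGLT_of_mem_Theta hβ) hσ
    hJ.map (by rwa [J.card_map])

theorem VarianceIdentified.countingRule (hvar : VarianceIdentified β σ) (hβ : β ∈ Theta δ)
    (hσ : ∀ i, 0 < σ i) (hlarge : ∀ J : Finset (Fin r), 3 ≤ J.card → 2 * J.card + 1 ≤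
      nonzeroRows δ J) : CountingRule δ 1 := fun J hJ => by
  obtain hJ3 | hJ2 := le_or_gt 3 J.card
  · exact hlarge J hJ3
  · exact hvar.two_mul_card_add_one_le_nonzeroRows_of_mem_Theta hβ hσ hJ (Nat.le_of_lt_succ hJ2)

end CountingRuleOfVarianceIdentified

theorem two_mul_card_add_one_le_nonzeroRows_of_three_le {m r : ℕ}
    {δ : Matrix (Fin m) (Fin r) Bool} (hr : r = 1 ∨ r = 2 ∨ (r = 3 ∧ 7 ≤ nonzeroRows δ Finset.univ))
    {J : Finset (Fin r)} (hJ : 3 ≤ J.card) : 2 * J.card + 1 ≤ nonzeroRows δ J := by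
  have hJr : J.card ≤ r := card_finset_fin_le J
  obtain ⟨hr3, hrows⟩ : r = 3 ∧ 7 ≤ nonzeroRows δ Finset.univ := by omega
  have hJuniv : J = Finset.univ := Finset.card_eq_iff_eq_univ J |>.mp (by simp; omega)
  rw [hJuniv, Finset.card_fin]
  omega

theorem corollary1_general {m r : ℕ} (δ : Matrix (Fin m) (Fin r) Bool)
    (hδ : IsUnorderedGLTSparsity δ) :
    (CountingRule δ 1 →
      ∃ N : Set (Matrix (Fin m) (Fin r) ℝ), IsNullInTheta δ N ∧
        ∀ β ∈ Theta δ, β ∉ N → ∀ (σ : Fin m → ℝ) (B : Matrix (Fin m) (Fin r) ℝ) (τ : Fin m → ℝ),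
          β * βᵀ + diagonal σ = B * Bᵀ + diagonal τ →
            τ = σ ∧ B * Bᵀ = β * βᵀ ∧ (IsUnorderedGLT B → IsSignedPermutation B β)) ∧
    (¬ CountingRule δ 1 → ∀ β ∈ Theta δ, ¬ RowDeletionProperty β) ∧
    ((∀ J : Finset (Fin r), 3 ≤ J.card → 2 * J.card + 1 ≤ nonzeroRows δ J) →
      (CountingRule δ 1 ↔
        ∃ N : Set (Matrix (Fin m) (Fin r) ℝ), IsNullInTheta δ N ∧
          ∀ β ∈ Theta δ, β ∉ N → ∀ σ : Fin m → ℝ, (∀ i, 0 < σ i) → VarianceIdentified β σ) ∧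
      (∀ β ∈ Theta δ, ∀ σ : Fin m → ℝ, (∀ i, 0 < σ i) → VarianceIdentified β σ →
        CountingRule δ 1)) := by
  refine ⟨fun h => ⟨_, h.isNullInTheta_not_rowDeletionProperty, fun β hβ hβN σ B τ hB => ?_⟩,
    fun h β hβ hAR => h (hAR.countingRule_of_mem_Theta hβ), fun hlarge => ?_⟩
  · obtain ⟨hτ, hgram⟩ := (not_not.mp hβN).eq_and_mul_transpose_eq hB
    exact ⟨hτ, hgram, fun hglt => (isUnorderedGLT_of_mem_Theta hβ).isSignedPermutation hglt hgram⟩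
  · refine ⟨⟨fun h => ⟨_, h.isNullInTheta_not_rowDeletionProperty, fun β _ hβN σ _ B τ hB =>
      (not_not.mp hβN).eq_and_mul_transpose_eq hB.2.2⟩, ?_⟩,
      fun β hβ σ hσ hvar => hvar.countingRule hβ hσ hlarge⟩
    rintro ⟨N, hN, hident⟩
    obtain ⟨β, hβ, hβN⟩ := hN.exists_mem_Theta_notMem hδ
    exact (hident β hβ hβN 1 fun _ => one_pos).countingRule hβ (fun _ => one_pos) hlarge

theorem corollary1 {m r : ℕ} (δ : Matrix (Fin m) (Fin r) Bool)
    (hδ : IsUnorderedGLTSparsity δ) :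
    -- (a)
    (CountingRule δ 1 →
      ∃ N : Set (Matrix (Fin m) (Fin r) ℝ), IsNullInTheta δ N ∧
        ∀ β ∈ Theta δ, β ∉ N → ∀ σ : Fin m → ℝ, (∀ i, 0 < σ i) →
          VarianceIdentified β σ ∧
          ∀ (B : Matrix (Fin m) (Fin r) ℝ) (τ : Fin m → ℝ),
            IsGLTDecomposition (β * βᵀ + Matrix.diagonal σ) B τ →
              τ = σ ∧ B * Bᵀ = β * βᵀ ∧ IsSignedPermutation B β) ∧
    -- (b)
    (¬ CountingRule δ 1 → ∀ β ∈ Theta δ, ¬ RowDeletionProperty β) ∧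
    -- (c)
    (r = 1 ∨ r = 2 ∨ (r = 3 ∧ 7 ≤ nonzeroRows δ Finset.univ) →
      (CountingRule δ 1 ↔
        ∃ N : Set (Matrix (Fin m) (Fin r) ℝ), IsNullInTheta δ N ∧
          ∀ β ∈ Theta δ, β ∉ N → ∀ σ : Fin m → ℝ, (∀ i, 0 < σ i) → VarianceIdentified β σ) ∧
      (∀ β ∈ Theta δ, ∀ σ : Fin m → ℝ, (∀ i, 0 < σ i) → VarianceIdentified β σ →
        CountingRule δ 1)) := by
  obtain ⟨ha, hb, hc⟩ := corollary1_general δ hδ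
  refine ⟨fun h => ?_, hb, fun hr => hc fun J => two_mul_card_add_one_le_nonzeroRows_of_three_le hr⟩
  obtain ⟨N, hN, hident⟩ := ha h
  refine ⟨N, hN, fun β hβ hβN σ _ => ⟨fun B τ hB => ?_, fun B τ hB => ?_⟩⟩
  · exact (hident β hβ hβN σ B τ hB.2.2).imp_right And.left
  · exact (hident β hβ hβN σ B τ hB.2.2).imp_right (And.imp_right fun h => h hB.1)
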